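/- Let $\mathbb{R}_+=(0,\infty)$. A mean on $\mathbb{R}_+$ is a function $\mathscr{M}\colon\bigcup_{n=1}^\infty\mathbb{R}_+^n\to\mathbb{R}_+$ with $\min(v)\le\mathscr{M}(v)\le\max(v)$ for every $v$ in its domain. It is called - homogeneous if $\mathscr{M}(tv)=t\,\mathscr{M}(v)$ for all $t>0$ and all $v$; - symmetric if, for every $n\ge1$, $\mathscr{M}|_{\mathbb{R}_+^n}$ is invariant under permutations of the variables; - Jensen concave if, for every $n\ge1$, $\mathscr{M}\big(\tfrac{x+y}{2}\big)\ge\tfrac12\big(\mathscr{M}(x)+\mathscr{M}(y)\big)$ for all $x,y\in\mathbb{R}_+^n$; - repetition invariant if, for all $n,m\ge1$ and $(v_1,\dots,v_n)\in\mathbb{R}_+^n$, $$\mathscr{M}(\underbrace{v_1,\dots,v_1}_{m},\dots,\underbrace{v_n,\dots,v_n}_{m})=\mathscr{M}(v_1,\dots,v_n);$$ - a Hardy mean if there is a finite constant $C$ such that $\sum_{n=1}^\infty\mathscr{M}(a_1,\dots,a_n)\le C\sum_{n=1}^\infty a_n$ for every summable sequence $(a_n)_{n\ge1}$ of positive reals;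 - a weak-Hardy mean if $\sum_{n=1}^\infty\mathscr{M}(a_1,\dots,a_n)<+\infty$ for every summable sequence $(a_n)_{n\ge1}$ of positive reals. **Proposition.** Let $\mathscr{M}$ be a homogeneous, symmetric, repetition invariant, and Jensen concave mean on $\mathbb{R}_+$. Then $\mathscr{M}$ is a Hardy mean if and only if it is a weak-Hardy mean. -/

import Mathlib

/-- `M n x` is the value of `M` at the `n`-tuple `x`. Only nonempty tuples with entries in the
interval `I` matter in the definitions below; all other values of `M` are irrelevant. -/
abbrev TupleFun : Type := (n : ℕ) → (Fin n → ℝ) → ℝ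

namespace TupleFun

/-- `M` is a mean on `I`: a function from nonempty tuples of elements of `I` to `I` with
`min x ≤ M x ≤ max x`. -/
def IsMean (I : Set ℝ) (M : TupleFun) : Prop :=
  ∀ n : ℕ, 0 < n → ∀ x : Fin n → ℝ, (∀ i, x i ∈ I) →
    M n x ∈ I ∧ (⨅ i, x i) ≤ M n x ∧ M n x ≤ ⨆ i, x i

/-- `M` is symmetric: every `n`-variable restriction is invariant under permutations. -/
def IsSymmetric (I : Set ℝ) (M : TupleFun) : Prop :=
  ∀ n : ℕ, 0 < n → ∀ x : Fin n → ℝ, (∀ i, x i ∈ I) →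
    ∀ σ : Equiv.Perm (Fin n), M n (fun i => x (σ i)) = M n x

/-- `M` is Jensen concave: every `n`-variable restriction is midpoint concave. -/
def IsJensenConcave (I : Set ℝ) (M : TupleFun) : Prop :=
  ∀ n : ℕ, 0 < n → ∀ x y : Fin n → ℝ, (∀ i, x i ∈ I) → (∀ i, y i ∈ I) →
    (M n x + M n y) / 2 ≤ M n (fun i => (x i + y i) / 2)

/-- `M` is repetition invariant: repeating each entry `m` times,
`(v₁, …, v₁, …, vₙ, …, vₙ)`, does not change the value. The entry in (zero-based) position `i`
of the long tuple is the one in position `i / m` of `v`. -/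
def IsRepetitionInvariant (I : Set ℝ) (M : TupleFun) : Prop :=
  ∀ n m : ℕ, 0 < n → 0 < m → ∀ v : Fin n → ℝ, (∀ i, v i ∈ I) →
    M (n * m) (fun i : Fin (n * m) => v i.divNat) = M n v

/-- `M` is homogeneous (for means on the positive half-line). -/
def IsHomogeneous (M : TupleFun) : Prop :=
  ∀ n : ℕ, 0 < n → ∀ x : Fin n → ℝ, (∀ i, 0 < x i) →
    ∀ t : ℝ, 0 < t → M n (fun i => t * x i) = t * M n x

/-- The sequence `M(a₁), M(a₁, a₂), M(a₁, a₂, a₃), …`; sequences are indexed from `0`. -/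
def prefixValues (M : TupleFun) (a : ℕ → ℝ) : ℕ → ℝ :=
  fun n => M (n + 1) (fun i : Fin (n + 1) => a i)

/-- `M` is a Hardy mean on `I`: for some finite `C`, every summable sequence `a` in `I` satisfies
`∑ M(a₁, …, aₙ) ≤ C ∑ aₙ` (in particular the left-hand side converges). -/
def IsHardy (I : Set ℝ) (M : TupleFun) : Prop :=
  ∃ C : ℝ, ∀ a : ℕ → ℝ, (∀ n, a n ∈ I) → Summable a →
    Summable (M.prefixValues a) ∧ ∑' n, M.prefixValues a n ≤ C * ∑' n, a n

/-- `M` is a weak-Hardy mean on `I`: `∑ M(a₁, …, aₙ)` converges for every summable sequence `a`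
in `I`. -/
def IsWeakHardy (I : Set ℝ) (M : TupleFun) : Prop :=
  ∀ a : ℕ → ℝ, (∀ n, a n ∈ I) → Summable a → Summable (M.prefixValues a)

end TupleFun

/-!
A positive Jensen concave function on the positive orthant is nondecreasing: along a nonnegative
direction `d`, the successive increments of `k ↦ M (x + k d)` do not increase, so a single strict
decrease would drive the values below `0` (`TupleFun.mono_of_isJensenConcave`).

Given monotonicity and homogeneity, the result is a uniform boundedness argument. If `M` is weak-Hardy
but no constant `C` works, then for each `j` there is a positive sequence `b j` which, after
rescaling, has sum `2⁻ʲ` and `∑ₙ M(b j 0, …, b j n) > 2ʲ`. The sequence `a = ∑ⱼ b j` is summable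
and dominates each `b j`, so by monotonicity `∑ₙ M(a 0, …, a n) > 2ʲ` for every `j`, which
contradicts the weak-Hardy property.
-/

namespace TupleFun

theorem IsHardy.isWeakHardy {I : Set ℝ} {M : TupleFun} (h : M.IsHardy I) : M.IsWeakHardy I := by
  obtain ⟨C, hC⟩ := h
  exact fun a ha hs => (hC a ha hs).1

/-- Midpoint concavity and positivity force monotonicity; no continuity is needed, since only the
points `x + k (y - x)` with `k` a natural number are used. -/
theorem mono_of_isJensenConcave {M : TupleFun} (hmean : M.IsMean (Set.Ioi 0))
    (hconc : M.IsJensenConcave (Set.Ioi 0)) {n : ℕ} (hn : 0 < n) {x y : Fin n → ℝ}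
    (hx : ∀ i, 0 < x i) (hxy : ∀ i, x i ≤ y i) : M n x ≤ M n y := by
  let g : ℕ → ℝ := fun k => M n (fun i => x i + k * (y i - x i))
  have hmem : ∀ (k : ℕ) (i : Fin n), x i + k * (y i - x i) ∈ Set.Ioi (0 : ℝ) := fun k i =>
    add_pos_of_pos_of_nonneg (hx i) (mul_nonneg k.cast_nonneg (sub_nonneg.2 (hxy i)))
  have hpos : ∀ k, 0 < g k := fun k => (hmean n hn _ (hmem k)).1
  have hstep : ∀ k, g (k + 2) - g (k + 1) ≤ g (k + 1) - g k := by
    intro k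
    have h := hconc n hn _ _ (hmem k) (hmem (k + 2))
    have hmid : (fun i => (x i + (k : ℕ) * (y i - x i) + (x i + (k + 2 : ℕ) * (y i - x i))) / 2)
        = fun i => x i + (k + 1 : ℕ) * (y i - x i) := by
      funext i
      push_cast
      ring
    rw [hmid] at h
    change (g k + g (k + 2)) / 2 ≤ g (k + 1) at h
    linarith
  have hincr : ∀ k, g (k + 1) - g k ≤ g 1 - g 0 := by
    intro k
    induction k with
    | zero => simp
    | succ k ih => exact (hstep k).trans ih
  have hlin : ∀ k : ℕ, g k ≤ g 0 + k * (g 1 - g 0) := by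
    intro k
    induction k with
    | zero => simp
    | succ k ih =>
      have := hincr k
      push_cast
      linarith
  have h0 : g 0 = M n x := by simp [g]
  have h1 : g 1 = M n y := by simp [g]
  by_contra! hlt
  rw [← h0, ← h1] at hlt
  obtain ⟨k, hk⟩ := exists_nat_gt (g 0 / (g 0 - g 1))
  rw [div_lt_iff₀ (sub_pos.2 hlt)] at hk
  have := hlin k
  have := hpos k
  linarith

theorem prefixValues_mul {M : TupleFun} (hhom : M.IsHomogeneous) {a : ℕ → ℝ}
    (ha : ∀ n, 0 < a n) {t : ℝ} (ht : 0 < t) (n : ℕ) :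
    M.prefixValues (fun k => t * a k) n = t * M.prefixValues a n :=
  hhom (n + 1) n.succ_pos _ (fun i => ha i) t ht

theorem prefixValues_mono {M : TupleFun} (hmean : M.IsMean (Set.Ioi 0))
    (hconc : M.IsJensenConcave (Set.Ioi 0)) {a b : ℕ → ℝ} (ha : ∀ n, 0 < a n)
    (hab : ∀ n, a n ≤ b n) (n : ℕ) : M.prefixValues a n ≤ M.prefixValues b n :=
  mono_of_isJensenConcave hmean hconc n.succ_pos (fun i => ha i) fun i => hab i

/-- If a homogeneous weak-Hardy mean is not Hardy, then the Hardy inequality fails for each constant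
on a sequence of any prescribed sum. -/
theorem exists_tsum_prefixValues_gt {M : TupleFun} (hhom : M.IsHomogeneous)
    (hweak : M.IsWeakHardy (Set.Ioi 0)) (hnot : ¬ M.IsHardy (Set.Ioi 0)) (C : ℝ) {s : ℝ}
    (hs : 0 < s) :
    ∃ b : ℕ → ℝ, (∀ n, 0 < b n) ∧ HasSum b s ∧ C * s < ∑' n, M.prefixValues b n := by
  simp only [IsHardy, not_exists, not_forall] at hnot
  obtain ⟨a, ha, hsum, hfail⟩ := hnot C
  have hlt : C * ∑' n, a n < ∑' n, M.prefixValues a n := by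
    by_contra! hle
    exact hfail ⟨hweak a ha hsum, hle⟩
  have hS : 0 < ∑' n, a n := hsum.tsum_pos (fun n => (ha n).le) 0 (ha 0)
  have ht : 0 < s / ∑' n, a n := div_pos hs hS
  refine ⟨fun n => s / (∑' n, a n) * a n, fun n => mul_pos ht (ha n), ?_, ?_⟩
  · simpa [div_mul_cancel₀ s hS.ne'] using hsum.hasSum.mul_left (s / ∑' n, a n)
  · rw [tsum_congr (prefixValues_mul hhom ha ht), tsum_mul_left]
    calc C * s = s / (∑' n, a n) * (C * ∑' n, a n) := by field_simp
      _ < _ := mul_lt_mul_of_pos_left hlt ht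

theorem IsWeakHardy.isHardy {M : TupleFun} (hmean : M.IsMean (Set.Ioi 0))
    (hhom : M.IsHomogeneous) (hconc : M.IsJensenConcave (Set.Ioi 0))
    (hweak : M.IsWeakHardy (Set.Ioi 0)) : M.IsHardy (Set.Ioi 0) := by
  by_contra hnot
  -- The constants `4 ^ j` outgrow the prescribed sums `2⁻ʲ`: their product is `2 ^ j`.
  choose b hbpos hbsum hbgt using fun j : ℕ =>
    exists_tsum_prefixValues_gt hhom hweak hnot (4 ^ j) (s := (1 / 2) ^ j) (by positivity)
  have hdouble : Summable fun p : ℕ × ℕ => b p.1 p.2 := by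
    refine (summable_prod_of_nonneg fun p => (hbpos p.1 p.2).le).2
      ⟨fun j => (hbsum j).summable, ?_⟩
    simpa only [(hbsum _).tsum_eq] using summable_geometric_two
  have hswap : Summable fun p : ℕ × ℕ => b p.2 p.1 := hdouble.prod_symm
  have hcol : ∀ n, Summable fun j => b j n := fun n => hswap.prod_factor n
  have hle : ∀ j n, b j n ≤ ∑' i, b i n := fun j n =>
    (hcol n).le_tsum j fun i _ => (hbpos i n).le
  have ha := hweak (fun n => ∑' j, b j n) (fun n => (hbpos 0 n).trans_le (hle 0 n)) hswap.prod
  obtain ⟨j, hj⟩ := pow_unbounded_of_one_lt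
    (∑' n, M.prefixValues (fun n => ∑' j, b j n) n) (one_lt_two : (1 : ℝ) < 2)
  have hcmp : ∑' n, M.prefixValues (b j) n ≤ ∑' n, M.prefixValues (fun n => ∑' j, b j n) n :=
    (hweak (b j) (hbpos j) (hbsum j).summable).tsum_le_tsum
      (prefixValues_mono hmean hconc (hbpos j) (hle j)) ha
  have hbj := hbgt j
  rw [← mul_pow, show (4 : ℝ) * (1 / 2) = 2 by norm_num] at hbj
  linarith

end TupleFun

theorem mainTheorem2 (M : TupleFun)
    (hmean : TupleFun.IsMean (Set.Ioi 0) M)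
    (hhom : TupleFun.IsHomogeneous M)
    (hsymm : TupleFun.IsSymmetric (Set.Ioi 0) M)
    (hrep : TupleFun.IsRepetitionInvariant (Set.Ioi 0) M)
    (hconc : TupleFun.IsJensenConcave (Set.Ioi 0) M) :
    TupleFun.IsHardy (Set.Ioi 0) M ↔ TupleFun.IsWeakHardy (Set.Ioi 0) M :=
  ⟨TupleFun.IsHardy.isWeakHardy, TupleFun.IsWeakHardy.isHardy hmean hhom hconc⟩
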